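/- Let $\Gamma=(V,E)$ be a finite simple graph. Orient each edge $e\in E$ arbitrarily, identify it with $[0,1]$, and let $\mathrm{init}(e),\mathrm{term}(e)\in V$ be the vertices at $x=0$ and $x=1$. For $u=(u_e)_{e\in E}\in C^2([0,1];\mathbb C)^E$ consider the boundary vectors $(u(0),u(1))$ and $(-u'(0),u'(1))$ in $\mathbb C^E\times\mathbb C^E$ (with its standard inner product), and put $$Y_\Gamma=\big\{\big((\varphi(\mathrm{init}(e)))_{e\in E},(\varphi(\mathrm{term}(e)))_{e\in E}\big) : \varphi\in\mathbb C^V\big\}\subset\mathbb C^E\times\mathbb C^E .$$ Let $\Delta^{CK}$ (continuity of the values, Kirchhoff condition for the outer normal derivatives) be the operator $u\mapsto(u_e'')_{e\in E}$ in $C([0,1];\mathbb C)^E$ whose domain consists of all $u\in C^2([0,1];\mathbb C)^E$ with $$(u(0),u(1))\in Y_\Gamma,\qquad (-u'(0),u'(1))\in Y_\Gamma^\perp,$$ and let $\Delta^{KC}$ (Kirchhoff condition for the values, continuity of the outer normal derivatives) be the same operator with $Y_\Gamma$ and $Y_\Gamma^\perp$ interchanged. Two graphs are called isospectral with respect to $-\Delta^{CK}$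 (respectively $-\Delta^{KC}$) if the corresponding operators have the same eigenvalues, each with the same multiplicity (dimension of the eigenspace). Let $\Gamma_1$ and $\Gamma_2$ be finite simple graphs, with arbitrary orientations of their edges. Then $\Gamma_1$ and $\Gamma_2$ are isospectral with respect to $-\Delta^{CK}$ if and only if they are isospectral with respect to $-\Delta^{KC}$. -/

import Mathlib

noncomputable section

namespace MetricGraph

/-! ### The second derivative on finitely many copies of `[0,1]` -/

/-- The space `C[0,1]` of continuous complex-valued functions on the closed unit interval. -/
abbrev C01 : Type := C(Set.Icc (0 : ℝ) 1, ℂ)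

/-- The extension of a function on `[0,1]` to `ℝ` by its boundary values. It is only ever
differentiated within `[0,1]`, so the values outside play no role. -/
def ext (f : C01) : ℝ → ℂ := Set.IccExtend (zero_le_one' ℝ) f

/-- `f ∈ C²[0,1]` (with one-sided derivatives at the end points). -/
def IsC2 (f : C01) : Prop := ContDiffOn ℝ 2 (ext f) (Set.Icc 0 1)

/-- The first derivative of a function on `[0,1]` (one-sided at the end points). -/
def d1 (f : C01) (x : ℝ) : ℂ := derivWithin (ext f) (Set.Icc 0 1) x

/-- The second derivative of a function on `[0,1]` (one-sided at the end points). -/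
def d2 (f : C01) (x : ℝ) : ℂ := iteratedDerivWithin 2 (ext f) (Set.Icc 0 1) x

theorem ext_add (f g : C01) : ext (f + g) = ext f + ext g := rfl

theorem ext_smul (c : ℂ) (f : C01) : ext (c • f) = c • ext f := rfl

theorem isC2_zero : IsC2 0 := contDiffOn_const (c := (0 : ℂ))

theorem IsC2.add {f g : C01} (hf : IsC2 f) (hg : IsC2 g) : IsC2 (f + g) :=
  ContDiffOn.add hf hg

theorem IsC2.smul {f : C01} (c : ℂ) (hf : IsC2 f) : IsC2 (c • f) :=
  ContDiffOn.const_smul c hf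

theorem IsC2.differentiableWithinAt {f : C01} (hf : IsC2 f) {x : ℝ} (hx : x ∈ Set.Icc (0 : ℝ) 1) :
    DifferentiableWithinAt ℝ (ext f) (Set.Icc 0 1) x :=
  (ContDiffOn.differentiableOn hf (by norm_num)) x hx

theorem d1_zero (x : ℝ) : d1 0 x = 0 := by
  have h : ext 0 = fun _ => (0 : ℂ) := rfl
  simp [d1, h]

theorem d1_add {f g : C01} (hf : IsC2 f) (hg : IsC2 g) {x : ℝ} (hx : x ∈ Set.Icc (0 : ℝ) 1) :
    d1 (f + g) x = d1 f x + d1 g x := by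
  rw [d1, ext_add]
  exact derivWithin_add (hf.differentiableWithinAt hx) (hg.differentiableWithinAt hx)

theorem d1_smul {f : C01} (hf : IsC2 f) (c : ℂ) {x : ℝ} (hx : x ∈ Set.Icc (0 : ℝ) 1) :
    d1 (c • f) x = c * d1 f x := by
  rw [d1, ext_smul]
  exact derivWithin_const_smul c (hf.differentiableWithinAt hx)

theorem d2_add {f g : C01} (hf : IsC2 f) (hg : IsC2 g) {x : ℝ} (hx : x ∈ Set.Icc (0 : ℝ) 1) :
    d2 (f + g) x = d2 f x + d2 g x := by
  rw [d2, ext_add]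
  exact iteratedDerivWithin_add hx (uniqueDiffOn_Icc zero_lt_one) (hf x hx) (hg x hx)

theorem d2_smul {f : C01} (hf : IsC2 f) (c : ℂ) {x : ℝ} (hx : x ∈ Set.Icc (0 : ℝ) 1) :
    d2 (c • f) x = c * d2 f x := by
  rw [d2, ext_smul]
  exact iteratedDerivWithin_const_smul hx (uniqueDiffOn_Icc zero_lt_one) c (hf x hx)

theorem IsC2.continuous_d2 {f : C01} (hf : IsC2 f) :
    Continuous fun x : Set.Icc (0 : ℝ) 1 => d2 f x :=
  (ContDiffOn.continuousOn_iteratedDerivWithin hf le_rfl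
    (uniqueDiffOn_Icc zero_lt_one)).domRestrict

variable {E : Type*}

/-- The boundary values `(u(0), u(1)) ∈ ℂ^E × ℂ^E` of `u : [0,1] → ℂ^E`. -/
def bdryValue (u : E → C01) : EuclideanSpace ℂ (E ⊕ E) :=
  WithLp.toLp 2 (Sum.elim (fun e => u e 0) (fun e => u e 1))

/-- The outer normal derivatives `(-u'(0), u'(1)) ∈ ℂ^E × ℂ^E` of `u : [0,1] → ℂ^E`. -/
def bdryNormalDeriv (u : E → C01) : EuclideanSpace ℂ (E ⊕ E) :=
  WithLp.toLp 2 (Sum.elim (fun e => -d1 (u e) 0) (fun e => d1 (u e) 1))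

variable [Fintype E]

/-- The functions `u ∈ C²[0,1]^E` with `(u(0), u(1)) ∈ Y` and `(-u'(0), u'(1)) ∈ Y^⊥`. -/
def laplacianDomain (Y : Submodule ℂ (EuclideanSpace ℂ (E ⊕ E))) : Submodule ℂ (E → C01) where
  carrier := {u | (∀ e, IsC2 (u e)) ∧ bdryValue u ∈ Y ∧ bdryNormalDeriv u ∈ Yᗮ}
  zero_mem' := by
    refine ⟨fun _ => isC2_zero, ?_, ?_⟩
    · convert Y.zero_mem using 1
      ext i; rcases i with i | i <;> simp [bdryValue]
    · convert Yᗮ.zero_mem using 1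
      ext i; rcases i with i | i <;> simp [bdryNormalDeriv, d1_zero]
  add_mem' := by
    rintro u v ⟨hu, hu0, hu1⟩ ⟨hv, hv0, hv1⟩
    refine ⟨fun e => (hu e).add (hv e), ?_, ?_⟩
    · convert Y.add_mem hu0 hv0 using 1
      ext i; rcases i with i | i <;> simp [bdryValue]
    · convert Yᗮ.add_mem hu1 hv1 using 1
      ext i; rcases i with i | i <;>
        simp [bdryNormalDeriv, d1_add (hu i) (hv i), add_comm]
  smul_mem' := by
    rintro c u ⟨hu, hu0, hu1⟩
    refine ⟨fun e => (hu e).smul c, ?_, ?_⟩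
    · convert Y.smul_mem c hu0 using 1
      ext i; rcases i with i | i <;> simp [bdryValue]
    · convert Yᗮ.smul_mem c hu1 using 1
      ext i; rcases i with i | i <;> simp [bdryNormalDeriv, d1_smul (hu i) c]

/-- The second derivative `Δ_Y u = (u_e'')_e` as an operator in `C[0,1]^E`, with domain the
`u ∈ C²[0,1]^E` such that `(u(0), u(1)) ∈ Y` and `(-u'(0), u'(1)) ∈ Y^⊥`. -/
def laplacian (Y : Submodule ℂ (EuclideanSpace ℂ (E ⊕ E))) : (E → C01) →ₗ.[ℂ] (E → C01) where
  domain := laplacianDomain Y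
  toFun :=
    { toFun := fun u e => ⟨fun x => d2 (u.1 e) x, (u.2.1 e).continuous_d2⟩
      map_add' := by
        intro u v
        ext e x
        exact d2_add (u.2.1 e) (v.2.1 e) x.2
      map_smul' := by
        intro c u
        ext e x
        exact d2_smul (u.2.1 e) c x.2 }

/-! ### Eigenvalues, multiplicities, isospectrality -/

/-- The space of solutions `u ∈ D(T)` of `T u = μ u`. -/
def eigenspace {F : Type*} [AddCommGroup F] [Module ℂ F] (T : F →ₗ.[ℂ] F) (μ : ℂ) :
    Submodule ℂ F where
  carrier := {u | ∃ h : u ∈ T.domain, T ⟨u, h⟩ = μ • u}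
  zero_mem' := ⟨T.domain.zero_mem, by
    have h : T ⟨0, T.domain.zero_mem⟩ = 0 := T.map_zero
    rw [h, smul_zero]⟩
  add_mem' := by
    rintro u v ⟨hu, hu'⟩ ⟨hv, hv'⟩
    refine ⟨T.domain.add_mem hu hv, ?_⟩
    have h := T.map_add ⟨u, hu⟩ ⟨v, hv⟩
    rw [hu', hv', ← smul_add] at h
    exact h
  smul_mem' := by
    rintro c u ⟨hu, hu'⟩
    refine ⟨T.domain.smul_mem c hu, ?_⟩
    have h := T.map_smul c ⟨u, hu⟩
    rw [hu', smul_comm] at h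
    exact h

/-- The multiplicity of `μ` as an eigenvalue of `T`, i.e. the dimension of its eigenspace
(it is `0` if and only if `μ` is not an eigenvalue). -/
def eigenMultiplicity {F : Type*} [AddCommGroup F] [Module ℂ F] (T : F →ₗ.[ℂ] F) (μ : ℂ) : ℕ∞ :=
  (Module.rank ℂ (eigenspace T μ)).toENat

/-- Two operators are isospectral if they have the same eigenvalues with the same
multiplicities. -/
def Isospectral {F₁ F₂ : Type*} [AddCommGroup F₁] [Module ℂ F₁] [AddCommGroup F₂] [Module ℂ F₂]
    (T₁ : F₁ →ₗ.[ℂ] F₁) (T₂ : F₂ →ₗ.[ℂ] F₂) : Prop :=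
  ∀ μ : ℂ, eigenMultiplicity T₁ μ = eigenMultiplicity T₂ μ

/-! ### The metric graph of a simple graph, and the two vertex conditions -/

variable {V : Type*}

/-- A parametrization of the edges of `G` by `[0,1]`: the edge `e` runs from `init e`
(at `x = 0`) to `term e` (at `x = 1`). -/
structure EdgeOrientation (G : SimpleGraph V) where
  init : G.edgeSet → V
  term : G.edgeSet → V
  ends_eq : ∀ e, s(init e, term e) = (e : Sym2 V)

variable [Fintype V] [DecidableEq V] {G : SimpleGraph V} [DecidableRel G.Adj]

/-- The signed incidence matrix `𝒟`: the entry at `(v, e)` is `1` if `e` ends at `v`, `-1` if `e`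
starts at `v`, and `0` otherwise. -/
def incidence (o : EdgeOrientation G) : Matrix V G.edgeSet ℝ :=
  fun v e => if o.term e = v then 1 else if o.init e = v then -1 else 0

/-- The matrix of `φ ↦ (φ(init e))_e, (φ(term e))_e`: the transposed negative part of the
incidence matrix on top of the transposed positive part. -/
def stackedIncidence (o : EdgeOrientation G) : Matrix (G.edgeSet ⊕ G.edgeSet) V ℂ :=
  Matrix.fromRows (Matrix.of fun e v => (((incidence o v e)⁻ : ℝ) : ℂ))
    (Matrix.of fun e v => (((incidence o v e)⁺ : ℝ) : ℂ))

/-- The range of the stacked incidence matrix: the boundary values of functions that are continuous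
at all vertices. -/
def vertexSpace (o : EdgeOrientation G) : Submodule ℂ (EuclideanSpace ℂ (G.edgeSet ⊕ G.edgeSet)) :=
  LinearMap.range (Matrix.toEuclideanLin (stackedIncidence o))

/-- `Δ^{CK}`: continuity of the values and Kirchhoff condition on the normal derivatives. -/
def laplacianCK (o : EdgeOrientation G) : (G.edgeSet → C01) →ₗ.[ℂ] (G.edgeSet → C01) :=
  laplacian (vertexSpace o)

/-- `Δ^{KC}`: Kirchhoff condition on the values and continuity of the normal derivatives. -/
def laplacianKC (o : EdgeOrientation G) : (G.edgeSet → C01) →ₗ.[ℂ] (G.edgeSet → C01) :=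
  laplacian (vertexSpace o)ᗮ

end MetricGraph

end

/-!
For `k ≠ 0` the solutions of `-u'' = k² u` on the edges are `u = a cos (k x) + b sin (k x)`. The
conditions that the boundary values lie in `Y` and the normal derivatives in `Yᗮ` become linear
conditions on `(a, b)` that depend on `k` only through `(cos k, sin k)`. The substitution
`(a, b) ↦ (-b, -a)` interchanges `Y` and `Yᗮ` at the cost of changing the sign of `cos k`, so the
multiplicity of `k²` for `Yᗮ` is that of `(π - k)²` for `Y` (of `(2π)²` if `k = π`).

This leaves the eigenvalue `0`, whose eigenfunctions are constant on every edge. When `sin k = 0`,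
the conditions on `a` and on `b` decouple: they say that a vector `(a, ±a)` lies in `Y` and a
vector `(b, ±b)` in `Yᗮ`. Comparing the dimensions of these intersections via
`{(a, a)}ᗮ = {(b, -b)}` shows that the multiplicities `m` of `Y` and `mᗮ` of `Yᗮ` satisfy
`2 (mᗮ(0) + m(0)) = m(π²) + m(4π²)`, so `m` determines `mᗮ(0)` as well.
-/

noncomputable section

namespace MetricGraph

open Module

/-! ### Derivatives within `C[0,1]` -/

/-- `g` is the derivative of `f` on `[0,1]`, one-sided at the end points. Keeping derivatives in
`C[0,1]` turns `-u'' = μ u` into a first-order system in a commutative algebra. -/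
def HasDeriv (f g : C01) : Prop :=
  ∀ x : Set.Icc (0 : ℝ) 1, HasDerivWithinAt (ext f) (g x) (Set.Icc 0 1) x

theorem ext_coe (f : C01) (x : Set.Icc (0 : ℝ) 1) : ext f x = f x :=
  Set.IccExtend_val _ _ x

theorem HasDeriv.of_hasDerivAt {F : ℝ → ℂ} {f g : C01} (hf : ∀ x : Set.Icc (0 : ℝ) 1, F x = f x)
    (hF : ∀ x : Set.Icc (0 : ℝ) 1, HasDerivAt F (g x) x) : HasDeriv f g := fun x =>
  (hF x).hasDerivWithinAt.congr (fun y hy => (ext_coe f ⟨y, hy⟩).trans (hf ⟨y, hy⟩).symm)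
    ((ext_coe f x).trans (hf x).symm)

theorem hasDeriv_const (c : ℂ) : HasDeriv (.const _ c) 0 := fun x =>
  hasDerivWithinAt_const (x : ℝ) _ c

namespace HasDeriv

variable {f f' g g' h : C01}

theorem add (hf : HasDeriv f f') (hg : HasDeriv g g') : HasDeriv (f + g) (f' + g') :=
  fun x => (hf x).add (hg x)

theorem sub (hf : HasDeriv f f') (hg : HasDeriv g g') : HasDeriv (f - g) (f' - g') :=
  fun x => (hf x).sub (hg x)

theorem const_smul (c : ℂ) (hf : HasDeriv f f') : HasDeriv (c • f) (c • f') :=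
  fun x => (hf x).const_smul c

theorem mul (hf : HasDeriv f f') (hg : HasDeriv g g') : HasDeriv (f * g) (f' * g + f * g') :=
  fun x => ((hf x).mul (hg x)).congr_deriv <| by simp [ext_coe]

theorem d1_eq (hf : HasDeriv f f') (x : Set.Icc (0 : ℝ) 1) : d1 f x = f' x :=
  (hf x).derivWithin (uniqueDiffOn_Icc zero_lt_one x x.2)

theorem eqOn_d1 (hf : HasDeriv f f') : Set.EqOn (d1 f) (ext f') (Set.Icc 0 1) := fun x hx =>
  (hf.d1_eq ⟨x, hx⟩).trans (ext_coe f' ⟨x, hx⟩).symm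

theorem unique (hg : HasDeriv f g) (hh : HasDeriv f h) : g = h :=
  ContinuousMap.ext fun x => (hg.d1_eq x).symm.trans (hh.d1_eq x)

theorem d2_eq (hf : HasDeriv f g) (hg : HasDeriv g h) (x : Set.Icc (0 : ℝ) 1) : d2 f x = h x := by
  have h1 : iteratedDerivWithin 1 (ext f) (Set.Icc 0 1) = d1 f :=
    iteratedDerivWithin_one
  rw [d2, iteratedDerivWithin_succ, h1, derivWithin_congr hf.eqOn_d1 (hf.eqOn_d1 x.2)]
  exact hg.d1_eq x

theorem contDiffOn_succ {n : ℕ} (hf : HasDeriv f f')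
    (hf' : ContDiffOn ℝ n (ext f') (Set.Icc 0 1)) :
    ContDiffOn ℝ (n + 1) (ext f) (Set.Icc 0 1) :=
  (contDiffOn_succ_iff_derivWithin (uniqueDiffOn_Icc zero_lt_one)).2
    ⟨fun x hx => (hf ⟨x, hx⟩).differentiableWithinAt, by simp, hf'.congr hf.eqOn_d1⟩

theorem isC2 (hf : HasDeriv f g) (hg : HasDeriv g h) : IsC2 f :=
  have hh : ContDiffOn ℝ (0 : ℕ) (ext h) (Set.Icc 0 1) :=
    contDiffOn_zero.2 (h.continuous.Icc_extend' : Continuous (ext h)).continuousOn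
  hf.contDiffOn_succ (n := 1) (hg.contDiffOn_succ hh)

theorem eq_smul_one (hf : HasDeriv f 0) : f = f 0 • 1 := by
  ext x
  have h : ext f x = ext f 0 :=
    constant_of_derivWithin_zero (fun y hy => (hf ⟨y, hy⟩).differentiableWithinAt)
      (fun y hy => hf.d1_eq ⟨y, Set.Ico_subset_Icc_self hy⟩) x x.2
  simpa [ext_coe] using h.trans (ext_coe f 0)

end HasDeriv

theorem IsC2.exists_hasDeriv {f : C01} (hf : IsC2 f) : ∃ g h, HasDeriv f g ∧ HasDeriv g h := by
  have hd1 : ContDiffOn ℝ 1 (d1 f) (Set.Icc 0 1) :=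
    ContDiffOn.derivWithin hf (uniqueDiffOn_Icc zero_lt_one) (by norm_num)
  let g : C01 := ⟨fun x => d1 f x, hd1.continuousOn.domRestrict⟩
  have hfg : HasDeriv f g := fun x => (hf.differentiableWithinAt x.2).hasDerivWithinAt
  have hg : ContDiffOn ℝ 1 (ext g) (Set.Icc 0 1) := hd1.congr fun x hx => (hfg.eqOn_d1 hx).symm
  exact ⟨g, ⟨fun x => d1 g x, (hg.continuousOn_derivWithin
    (uniqueDiffOn_Icc zero_lt_one) le_rfl).domRestrict⟩, hfg,
    fun x => (hg.differentiableOn one_ne_zero x x.2).hasDerivWithinAt⟩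

/-! ### The solutions of `-u'' = k² u` -/

/-- The function `x ↦ cos (k x)` on `[0,1]`. -/
def cosMode (k : ℂ) : C01 := ⟨fun x => Complex.cos (k * (x : ℝ)), by fun_prop⟩

/-- The function `x ↦ sin (k x)` on `[0,1]`. -/
def sinMode (k : ℂ) : C01 := ⟨fun x => Complex.sin (k * (x : ℝ)), by fun_prop⟩

theorem hasDerivAt_const_mul_ofReal (k : ℂ) (x : ℝ) :
    HasDerivAt (fun y : ℝ => k * (y : ℂ)) k x := by
  simpa using (Complex.ofRealCLM.hasDerivAt (x := x)).const_mul k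

theorem hasDeriv_cosMode (k : ℂ) : HasDeriv (cosMode k) (-k • sinMode k) :=
  .of_hasDerivAt (fun _ => rfl) fun x =>
    ((Complex.hasDerivAt_cos _).comp (x : ℝ) (hasDerivAt_const_mul_ofReal k x)).congr_deriv <| by
      simp [sinMode, mul_comm]

theorem hasDeriv_sinMode (k : ℂ) : HasDeriv (sinMode k) (k • cosMode k) :=
  .of_hasDerivAt (fun _ => rfl) fun x =>
    ((Complex.hasDerivAt_sin _).comp (x : ℝ) (hasDerivAt_const_mul_ofReal k x)).congr_deriv <| by
      simp [cosMode, mul_comm]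

@[simp] theorem cosMode_zero (k : ℂ) : cosMode k 0 = 1 := by simp [cosMode]

@[simp] theorem sinMode_zero (k : ℂ) : sinMode k 0 = 0 := by simp [sinMode]

@[simp] theorem cosMode_one (k : ℂ) : cosMode k 1 = Complex.cos k := by simp [cosMode]

@[simp] theorem sinMode_one (k : ℂ) : sinMode k 1 = Complex.sin k := by simp [sinMode]

theorem sinMode_sq_add_cosMode_sq (k : ℂ) : sinMode k ^ 2 + cosMode k ^ 2 = 1 :=
  ContinuousMap.ext fun _ => Complex.sin_sq_add_cos_sq _

-- The rotation of `(f, g)` by the angle `-k x` is constant.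
theorem eq_smul_cosMode_add_smul_sinMode {k : ℂ} {f g : C01} (hf : HasDeriv f (k • g))
    (hg : HasDeriv g (-k • f)) : f = f 0 • cosMode k + g 0 • sinMode k := by
  have hp : HasDeriv (f * cosMode k - g * sinMode k) 0 := by
    convert (hf.mul (hasDeriv_cosMode k)).sub (hg.mul (hasDeriv_sinMode k)) using 1
    ext x
    simp only [ContinuousMap.zero_apply, ContinuousMap.sub_apply, ContinuousMap.add_apply,
      ContinuousMap.mul_apply, ContinuousMap.smul_apply, smul_eq_mul]
    ring
  have hq : HasDeriv (f * sinMode k + g * cosMode k) 0 := by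
    convert (hf.mul (hasDeriv_sinMode k)).add (hg.mul (hasDeriv_cosMode k)) using 1
    ext x
    simp only [ContinuousMap.zero_apply, ContinuousMap.add_apply, ContinuousMap.mul_apply,
      ContinuousMap.smul_apply, smul_eq_mul]
    ring
  calc
    f = (f * cosMode k - g * sinMode k) * cosMode k +
        (f * sinMode k + g * cosMode k) * sinMode k := by
      linear_combination -f * sinMode_sq_add_cosMode_sq k
    _ = f 0 • cosMode k + g 0 • sinMode k := by
      rw [hp.eq_smul_one, hq.eq_smul_one]
      simp

theorem HasDeriv.apply_one_eq {f : C01} {b : ℂ} (hf : HasDeriv f (b • 1)) : f 1 = f 0 + b := by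
  let X : C01 := ⟨fun x => ((x : ℝ) : ℂ), by fun_prop⟩
  have hX : HasDeriv X 1 := .of_hasDerivAt (fun _ => rfl) fun _ => Complex.ofRealCLM.hasDerivAt
  have h : HasDeriv (f - b • X) 0 := by simpa using hf.sub (hX.const_smul b)
  have h1 := DFunLike.congr_fun h.eq_smul_one 1
  simpa [X, sub_eq_iff_eq_add] using h1

/-! ### Eigenspaces as spaces of coefficient vectors -/

section Eigenspaces

variable {E : Type*}

/-- The vector of `ℂ^E × ℂ^E` with the given values at the initial and the terminal end points. -/
def bdryVector : ((E → ℂ) × (E → ℂ)) ≃ₗ[ℂ] EuclideanSpace ℂ (E ⊕ E) :=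
  (LinearEquiv.sumArrowLequivProdArrow E E ℂ ℂ).symm ≪≫ₗ (WithLp.linearEquiv 2 ℂ (E ⊕ E → ℂ)).symm

theorem bdryNormalDeriv_eq {u v : E → C01} (huv : ∀ e, HasDeriv (u e) (v e)) :
    bdryNormalDeriv u = bdryVector (-fun e => v e 0, fun e => v e 1) := by
  ext (e | e)
  · exact congrArg Neg.neg ((huv e).d1_eq 0)
  · exact (huv e).d1_eq 1

/-- The map `a ↦ (a_e f)_e`, giving the functions that are multiples of `f` on every edge. -/
def edgewiseSMul (f : C01) : (E → ℂ) →ₗ[ℂ] (E → C01) :=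
  (LinearMap.toSpanSingleton ℂ C01 f).compLeft E

theorem edgewiseSMul_one_injective :
    Function.Injective (edgewiseSMul (E := E) 1) := fun a b h =>
  funext fun e => by simpa [edgewiseSMul] using DFunLike.congr_fun (congrFun h e) 0

/-- The map `(a, b) ↦ (a_e cos (k x) + b_e sin (k x))_e`, which for `k ≠ 0` parametrizes the
solutions of `-u'' = k² u`. -/
def trigMode (k : ℂ) : ((E → ℂ) × (E → ℂ)) →ₗ[ℂ] (E → C01) :=
  (edgewiseSMul (cosMode k)).coprod (edgewiseSMul (sinMode k))

theorem trigMode_apply (k : ℂ) (p : (E → ℂ) × (E → ℂ)) (e : E) :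
    trigMode k p e = p.1 e • cosMode k + p.2 e • sinMode k := rfl

theorem trigMode_apply_zero (k : ℂ) (p : (E → ℂ) × (E → ℂ)) :
    (fun e => trigMode k p e 0) = p.1 := by
  ext e
  simp [trigMode_apply]

theorem trigMode_apply_one (k : ℂ) (p : (E → ℂ) × (E → ℂ)) :
    (fun e => trigMode k p e 1) = Complex.cos k • p.1 + Complex.sin k • p.2 := by
  ext e
  simp [trigMode_apply, mul_comm]

theorem hasDeriv_trigMode (k : ℂ) (p : (E → ℂ) × (E → ℂ)) (e : E) :
    HasDeriv (trigMode k p e) (trigMode k (k • (p.2, -p.1)) e) := by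
  have hderiv : trigMode k (k • (p.2, -p.1)) e =
      p.1 e • -k • sinMode k + p.2 e • k • cosMode k := by
    change (k * p.2 e) • cosMode k + (k * -p.1 e) • sinMode k = _
    module
  rw [hderiv, trigMode_apply]
  exact ((hasDeriv_cosMode k).const_smul _).add ((hasDeriv_sinMode k).const_smul _)

theorem hasDeriv_trigMode_deriv (k : ℂ) (p : (E → ℂ) × (E → ℂ)) (e : E) :
    HasDeriv (trigMode k (k • (p.2, -p.1)) e) (-k ^ 2 • trigMode k p e) := by
  have hsq : k • ((k • (p.2, -p.1)).2, -(k • (p.2, -p.1)).1) = -k ^ 2 • p := by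
    refine Prod.ext ?_ ?_
    · change k • k • -p.1 = -k ^ 2 • p.1
      module
    · change k • -(k • p.2) = -k ^ 2 • p.2
      module
  simpa only [hsq, map_smul, Pi.smul_apply] using hasDeriv_trigMode k (k • (p.2, -p.1)) e

theorem trigMode_injective {k : ℂ} (hk : k ≠ 0) : Function.Injective (trigMode (E := E) k) := by
  refine (injective_iff_map_eq_zero _).2 fun p hp => ?_
  have hderiv : trigMode k (k • (p.2, -p.1)) = 0 := by
    ext1 e
    have hzero : HasDeriv (trigMode k p e) 0 := by
      rw [hp]
      exact hasDeriv_const 0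
    exact (hasDeriv_trigMode k p e).unique hzero
  have ha : p.1 = 0 := by rw [← trigMode_apply_zero k p, hp]; rfl
  have hb : k • p.2 = 0 := by
    rw [← Prod.smul_fst k (p.2, -p.1), ← trigMode_apply_zero, hderiv]; rfl
  exact Prod.ext ha ((smul_eq_zero.1 hb).resolve_left hk)

/-- The map `a ↦ (a_e, c a_e)_e`, whose range is the graph of the multiplication by `c`. -/
def graphMap (c : ℂ) : (E → ℂ) →ₗ[ℂ] EuclideanSpace ℂ (E ⊕ E) :=
  bdryVector.toLinearMap ∘ₗ LinearMap.id.prod (c • LinearMap.id)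

theorem graphMap_apply (c : ℂ) (a : E → ℂ) : graphMap c a = bdryVector (a, c • a) := rfl

variable [Fintype E]

/-- The coefficients `(a, b)` for which `a cos (k x) + b sin (k x)`, where `c = cos k` and
`s = sin k`, satisfies the boundary conditions given by `Y`; the outer normal derivatives are
divided by `k`. -/
def modeCoefficients (Y : Submodule ℂ (EuclideanSpace ℂ (E ⊕ E))) (c s : ℂ) :
    Submodule ℂ ((E → ℂ) × (E → ℂ)) :=
  let a := LinearMap.fst ℂ (E → ℂ) (E → ℂ)
  let b := LinearMap.snd ℂ (E → ℂ) (E → ℂ)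
  Y.comap (bdryVector.toLinearMap ∘ₗ a.prod (c • a + s • b)) ⊓
    Yᗮ.comap (bdryVector.toLinearMap ∘ₗ (-b).prod (c • b - s • a))

variable {Y : Submodule ℂ (EuclideanSpace ℂ (E ⊕ E))}

theorem mem_modeCoefficients {c s : ℂ} {p : (E → ℂ) × (E → ℂ)} :
    p ∈ modeCoefficients Y c s ↔ bdryVector (p.1, c • p.1 + s • p.2) ∈ Y ∧
      bdryVector (-p.2, c • p.2 - s • p.1) ∈ Yᗮ :=
  Iff.rfl

theorem exists_hasDeriv_of_mem_eigenspace {μ : ℂ} {u : E → C01}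
    (hu : u ∈ eigenspace (-laplacian Y) μ) :
    ∃ v : E → C01, (∀ e, HasDeriv (u e) (v e)) ∧ ∀ e, HasDeriv (v e) (-μ • u e) := by
  obtain ⟨⟨hC2, _, _⟩, heq⟩ := hu
  choose v w huv hvw using fun e => (hC2 e).exists_hasDeriv
  refine ⟨v, huv, fun e => ?_⟩
  convert hvw e using 1
  ext x
  have h : -d2 (u e) x = μ * u e x := DFunLike.congr_fun (congrFun heq e) x
  rw [(huv e).d2_eq (hvw e)] at h
  simp [← h]

theorem mem_eigenspace_iff_of_hasDeriv {μ : ℂ} {u v : E → C01} (huv : ∀ e, HasDeriv (u e) (v e))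
    (hvu : ∀ e, HasDeriv (v e) (-μ • u e)) :
    u ∈ eigenspace (-laplacian Y) μ ↔ bdryVector (fun e => u e 0, fun e => u e 1) ∈ Y ∧
      bdryVector (-fun e => v e 0, fun e => v e 1) ∈ Yᗮ := by
  rw [← bdryNormalDeriv_eq huv]
  refine ⟨fun ⟨⟨_, hY, hY'⟩, _⟩ => ⟨hY, hY'⟩, fun ⟨hY, hY'⟩ =>
    ⟨⟨fun e => (huv e).isC2 (hvu e), hY, hY'⟩, ?_⟩⟩
  ext e x
  change -d2 (u e) x = μ * u e x
  simp [(huv e).d2_eq (hvu e) x]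

theorem trigMode_mem_eigenspace_iff {k : ℂ} (hk : k ≠ 0) {p : (E → ℂ) × (E → ℂ)} :
    trigMode k p ∈ eigenspace (-laplacian Y) (k ^ 2) ↔
      p ∈ modeCoefficients Y (Complex.cos k) (Complex.sin k) := by
  have hscale : (-(k • (p.2, -p.1)).1,
      Complex.cos k • (k • (p.2, -p.1)).1 + Complex.sin k • (k • (p.2, -p.1)).2) =
      k • (-p.2, Complex.cos k • p.2 - Complex.sin k • p.1) := by
    refine Prod.ext (smul_neg k p.2).symm ?_
    change Complex.cos k • k • p.2 + Complex.sin k • k • -p.1 =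
      k • (Complex.cos k • p.2 - Complex.sin k • p.1)
    module
  rw [mem_eigenspace_iff_of_hasDeriv (hasDeriv_trigMode k p) (hasDeriv_trigMode_deriv k p),
    trigMode_apply_zero, trigMode_apply_one, trigMode_apply_zero, trigMode_apply_one, hscale,
    map_smul, Submodule.smul_mem_iff _ hk, mem_modeCoefficients]

theorem eigenspace_sq_eq_map {k : ℂ} (hk : k ≠ 0) :
    eigenspace (-laplacian Y) (k ^ 2) =
      (modeCoefficients Y (Complex.cos k) (Complex.sin k)).map (trigMode k) := by
  ext u
  rw [Submodule.mem_map]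
  constructor
  · intro hu
    obtain ⟨v, huv, hvu⟩ := exists_hasDeriv_of_mem_eigenspace hu
    have huw : ∀ e, HasDeriv (u e) (k • k⁻¹ • v e) := fun e => by
      simpa only [smul_inv_smul₀ hk] using huv e
    have hwu : ∀ e, HasDeriv (k⁻¹ • v e) (-k • u e) := fun e => by
      convert (hvu e).const_smul k⁻¹ using 1
      rw [smul_smul]
      congr 1
      field_simp
    have hmode : trigMode k (fun e => u e 0, fun e => (k⁻¹ • v e) 0) = u :=
      funext fun e => (eq_smul_cosMode_add_smul_sinMode (huw e) (hwu e)).symm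
    exact ⟨_, (trigMode_mem_eigenspace_iff hk).1 (hmode.symm ▸ hu), hmode⟩
  · rintro ⟨p, hp, rfl⟩
    exact (trigMode_mem_eigenspace_iff hk).2 hp

theorem inner_bdryVector (p q : (E → ℂ) × (E → ℂ)) :
    inner ℂ (bdryVector p) (bdryVector q) = q.1 ⬝ᵥ star p.1 + q.2 ⬝ᵥ star p.2 := by
  rw [← sumElim_dotProduct_sumElim, ← Function.star_sumElim]
  exact EuclideanSpace.inner_eq_star_dotProduct _ _

open scoped ComplexOrder in
theorem eq_zero_of_bdryVector_mem_orthogonal {a b : E → ℂ} (hY : bdryVector (a, a + b) ∈ Y)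
    (hY' : bdryVector (-b, b) ∈ Yᗮ) : b = 0 := by
  have h := Submodule.inner_right_of_mem_orthogonal hY hY'
  rw [inner_bdryVector] at h
  simpa [dotProduct_add, dotProduct_self_star_eq_zero] using h

theorem hasDeriv_zero_of_mem_eigenspace_zero {u : E → C01}
    (hu : u ∈ eigenspace (-laplacian Y) 0) (e : E) : HasDeriv (u e) 0 := by
  obtain ⟨v, huv, hvu⟩ := exists_hasDeriv_of_mem_eigenspace hu
  obtain ⟨hY, hY'⟩ := (mem_eigenspace_iff_of_hasDeriv huv hvu).1 hu
  have hv : ∀ e, v e = v e 0 • 1 := fun e => by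
    have h := hvu e
    rw [neg_zero, zero_smul ℂ (u e)] at h
    exact h.eq_smul_one
  have hu1 : (fun e => u e 1) = (fun e => u e 0) + fun e => v e 0 :=
    funext fun e => (hv e ▸ huv e).apply_one_eq
  have hv1 : (fun e => v e 1) = fun e => v e 0 :=
    funext fun e => by rw [hv e]; simp
  have hv0 : (fun e => v e 0) = 0 :=
    eq_zero_of_bdryVector_mem_orthogonal (hu1 ▸ hY) (hv1 ▸ hY')
  have h := huv e
  rwa [hv e, congrFun hv0 e, Pi.zero_apply, zero_smul ℂ (1 : C01)] at h

theorem edgewiseSMul_one_mem_eigenspace_zero_iff {a : E → ℂ} :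
    edgewiseSMul 1 a ∈ eigenspace (-laplacian Y) 0 ↔ graphMap 1 a ∈ Y := by
  have huv : ∀ e, HasDeriv (edgewiseSMul 1 a e) 0 := fun e => hasDeriv_const (a e • 1)
  have hvu : ∀ e, HasDeriv 0 (-(0 : ℂ) • edgewiseSMul 1 a e) := fun e => by
    rw [neg_zero, zero_smul ℂ (edgewiseSMul 1 a e)]
    exact hasDeriv_const 0
  have hzero : bdryVector (-(0 : E → ℂ), (0 : E → ℂ)) ∈ Yᗮ := by
    simp only [neg_zero, Prod.mk_zero_zero, map_zero, zero_mem]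
  have hbdry : bdryVector (fun e => edgewiseSMul 1 a e 0, fun e => edgewiseSMul 1 a e 1) =
      graphMap 1 a := by
    simp [graphMap_apply, edgewiseSMul]
  rw [mem_eigenspace_iff_of_hasDeriv (v := 0) huv hvu, hbdry]
  exact and_iff_left hzero

theorem eigenspace_zero_eq_map :
    eigenspace (-laplacian Y) 0 = (Y.comap (graphMap 1)).map (edgewiseSMul 1) := by
  ext u
  rw [Submodule.mem_map]
  constructor
  · intro hu
    have hconst : edgewiseSMul 1 (fun e => u e 0) = u :=
      funext fun e => (hasDeriv_zero_of_mem_eigenspace_zero hu e).eq_smul_one.symm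
    exact ⟨_, edgewiseSMul_one_mem_eigenspace_zero_iff.1 (hconst.symm ▸ hu), hconst⟩
  · rintro ⟨a, ha, rfl⟩
    exact edgewiseSMul_one_mem_eigenspace_zero_iff.2 ha

instance finiteDimensional_eigenspace (μ : ℂ) :
    FiniteDimensional ℂ (eigenspace (-laplacian Y) μ) := by
  obtain ⟨k, rfl⟩ := IsAlgClosed.exists_pow_nat_eq μ two_pos
  rcases eq_or_ne k 0 with rfl | hk
  · rw [zero_pow two_ne_zero, eigenspace_zero_eq_map]
    infer_instance
  · rw [eigenspace_sq_eq_map hk]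
    infer_instance

theorem finrank_eigenspace_sq (Y : Submodule ℂ (EuclideanSpace ℂ (E ⊕ E))) {k : ℂ} (hk : k ≠ 0) :
    finrank ℂ (eigenspace (-laplacian Y) (k ^ 2)) =
      finrank ℂ (modeCoefficients Y (Complex.cos k) (Complex.sin k)) := by
  rw [eigenspace_sq_eq_map hk]
  exact (Submodule.equivMapOfInjective _ (trigMode_injective hk) _).finrank_eq.symm

theorem finrank_eigenspace_zero (Y : Submodule ℂ (EuclideanSpace ℂ (E ⊕ E))) :
    finrank ℂ (eigenspace (-laplacian Y) 0) = finrank ℂ (Y.comap (graphMap 1)) := by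
  rw [eigenspace_zero_eq_map]
  exact (Submodule.equivMapOfInjective _ edgewiseSMul_one_injective _).finrank_eq.symm

end Eigenspaces

/-! ### Interchanging a space with its orthogonal complement -/

theorem finrank_submodule_prod {K M N : Type*} [DivisionRing K] [AddCommGroup M] [Module K M]
    [AddCommGroup N] [Module K N] (p : Submodule K M) (q : Submodule K N)
    [FiniteDimensional K p] [FiniteDimensional K q] :
    finrank K (p.prod q) = finrank K p + finrank K q := by
  rw [← finrank_prod]
  exact LinearEquiv.finrank_eq
    { toFun := fun x => (⟨x.1.1, x.2.1⟩, ⟨x.1.2, x.2.2⟩)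
      invFun := fun x => ⟨(x.1, x.2), x.1.2, x.2.2⟩
      map_add' := fun _ _ => rfl
      map_smul' := fun _ _ => rfl }

theorem finrank_comap_eq_finrank_inf_range {R M N : Type*} [Semiring R] [AddCommMonoid M]
    [Module R M] [AddCommMonoid N] [Module R N] {f : M →ₗ[R] N} (hf : Function.Injective f)
    (q : Submodule R N) : finrank R (q.comap f) = finrank R ↥(q ⊓ f.range) := by
  rw [inf_comm, ← Submodule.map_comap_eq]
  exact (Submodule.equivMapOfInjective f hf _).finrank_eq

theorem finrank_orthogonal_inf_orthogonal_add {𝕜 V : Type*} [RCLike 𝕜] [NormedAddCommGroup V]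
    [InnerProductSpace 𝕜 V] [FiniteDimensional 𝕜 V] (K L : Submodule 𝕜 V) :
    finrank 𝕜 ↥(Kᗮ ⊓ Lᗮ) + (finrank 𝕜 K + finrank 𝕜 L) =
      finrank 𝕜 V + finrank 𝕜 ↥(K ⊓ L) := by
  have hsup := Submodule.finrank_sup_add_finrank_inf_eq K L
  have horth := (K ⊔ L).finrank_add_finrank_orthogonal
  rw [← Submodule.inf_orthogonal] at horth
  omega

theorem exists_cos_eq_neg_cos_and_sin_eq_sin (k : ℂ) :
    ∃ k' ≠ 0, Complex.cos k' = -Complex.cos k ∧ Complex.sin k' = Complex.sin k := by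
  rcases eq_or_ne k Real.pi with rfl | hk
  · exact ⟨2 * Real.pi, by simp [Real.pi_ne_zero], by simp⟩
  · exact ⟨Real.pi - k, sub_ne_zero.2 hk.symm, Complex.cos_pi_sub k, Complex.sin_pi_sub k⟩

section Duality

variable {E : Type*}

theorem graphMap_injective (c : ℂ) : Function.Injective (graphMap (E := E) c) := fun _ _ h =>
  congrArg Prod.fst (bdryVector.injective h)

variable [Fintype E] (Y : Submodule ℂ (EuclideanSpace ℂ (E ⊕ E)))

theorem finrank_modeCoefficients_orthogonal (c s : ℂ) :
    finrank ℂ (modeCoefficients Yᗮ c s) = finrank ℂ (modeCoefficients Y (-c) s) := by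
  let σ : ((E → ℂ) × (E → ℂ)) ≃ₗ[ℂ] ((E → ℂ) × (E → ℂ)) :=
    LinearEquiv.prodComm ℂ _ _ ≪≫ₗ LinearEquiv.neg ℂ
  have hσ : (modeCoefficients Y (-c) s).comap σ.toLinearMap = modeCoefficients Yᗮ c s := by
    ext ⟨a, b⟩
    have hb : -c • -b + s • -a = c • b - s • a := by module
    have ha : -c • -a - s • -b = c • a + s • b := by module
    rw [Submodule.mem_comap]
    change bdryVector (-b, -c • -b + s • -a) ∈ Y ∧ bdryVector (- -a, -c • -a - s • -b) ∈ Yᗮ ↔ _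
    rw [mem_modeCoefficients, Submodule.orthogonal_orthogonal, hb, ha, neg_neg, and_comm]
  rw [← hσ]
  exact (σ.ofSubmodule' _).finrank_eq

theorem finrank_eigenspace_sq_orthogonal {k k' : ℂ} (hk : k ≠ 0) (hk' : k' ≠ 0)
    (hcos : Complex.cos k' = -Complex.cos k) (hsin : Complex.sin k' = Complex.sin k) :
    finrank ℂ (eigenspace (-laplacian Yᗮ) (k ^ 2)) =
      finrank ℂ (eigenspace (-laplacian Y) (k' ^ 2)) := by
  rw [finrank_eigenspace_sq _ hk, finrank_eigenspace_sq _ hk', hcos, hsin,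
    finrank_modeCoefficients_orthogonal]

theorem finrank_modeCoefficients_zero (c : ℂ) :
    finrank ℂ (modeCoefficients Y c 0) =
      finrank ℂ (Y.comap (graphMap c)) + finrank ℂ (Yᗮ.comap (graphMap (-c))) := by
  have hprod : modeCoefficients Y c 0 =
      (Y.comap (graphMap c)).prod (Yᗮ.comap (graphMap (-c))) := by
    ext ⟨a, b⟩
    have hb : bdryVector (-b, c • b) = -graphMap (-c) b := by
      rw [graphMap_apply, ← map_neg, Prod.neg_mk, neg_smul, neg_neg]
    rw [mem_modeCoefficients, Submodule.mem_prod, Submodule.mem_comap, Submodule.mem_comap]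
    simp only [zero_smul, add_zero, sub_zero, hb, neg_mem_iff, graphMap_apply]
  rw [hprod, finrank_submodule_prod]

theorem finrank_range_graphMap (c : ℂ) :
    finrank ℂ (graphMap (E := E) c).range = Fintype.card E := by
  rw [LinearMap.finrank_range_of_inj (graphMap_injective c), finrank_fintype_fun_eq_card]

theorem orthogonal_range_graphMap {c c' : ℂ} (h : star c * c' = -1) :
    (graphMap (E := E) c).rangeᗮ = (graphMap c').range := by
  symm
  apply Submodule.eq_of_le_of_finrank_eq
  · rintro _ ⟨b, rfl⟩
    rw [Submodule.mem_orthogonal]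
    rintro _ ⟨a, rfl⟩
    rw [graphMap_apply, graphMap_apply, inner_bdryVector, star_smul, dotProduct_smul,
      smul_dotProduct, smul_smul, h]
    simp
  · have horth := (graphMap (E := E) c).range.finrank_add_finrank_orthogonal
    rw [finrank_range_graphMap, finrank_euclideanSpace, Fintype.card_sum] at horth
    rw [finrank_range_graphMap]
    omega

theorem finrank_comap_graphMap_orthogonal {c c' : ℂ} (h : star c * c' = -1) :
    finrank ℂ (Yᗮ.comap (graphMap c')) + finrank ℂ Y =
      Fintype.card E + finrank ℂ (Y.comap (graphMap c)) := by
  have hdim := finrank_orthogonal_inf_orthogonal_add Y (graphMap c).range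
  rw [orthogonal_range_graphMap h,
    ← finrank_comap_eq_finrank_inf_range (graphMap_injective c),
    ← finrank_comap_eq_finrank_inf_range (graphMap_injective c'), finrank_range_graphMap,
    finrank_euclideanSpace, Fintype.card_sum] at hdim
  omega

theorem finrank_eigenspace_zero_orthogonal_add :
    2 * (finrank ℂ (eigenspace (-laplacian Yᗮ) 0) + finrank ℂ (eigenspace (-laplacian Y) 0)) =
      finrank ℂ (eigenspace (-laplacian Y) (Real.pi ^ 2)) +
        finrank ℂ (eigenspace (-laplacian Y) ((2 * Real.pi) ^ 2)) := by
  have hpi : (Real.pi : ℂ) ≠ 0 := by simp [Real.pi_ne_zero]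
  have hcos : finrank ℂ (Yᗮ.comap (graphMap (-1))) + finrank ℂ Y =
      Fintype.card E + finrank ℂ (Y.comap (graphMap 1)) :=
    finrank_comap_graphMap_orthogonal Y (by simp)
  have hcos' : finrank ℂ (Yᗮ.comap (graphMap 1)) + finrank ℂ Y =
      Fintype.card E + finrank ℂ (Y.comap (graphMap (-1))) :=
    finrank_comap_graphMap_orthogonal Y (by simp)
  rw [finrank_eigenspace_zero, finrank_eigenspace_zero, finrank_eigenspace_sq Y hpi,
    finrank_eigenspace_sq Y (mul_ne_zero two_ne_zero hpi), Complex.cos_pi, Complex.sin_pi,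
    Complex.cos_two_pi, Complex.sin_two_pi, finrank_modeCoefficients_zero,
    finrank_modeCoefficients_zero, neg_neg]
  omega

end Duality

/-! ### Isospectrality -/

section Isospectrality

variable {E₁ E₂ : Type*} [Fintype E₁] [Fintype E₂]
  {Y₁ : Submodule ℂ (EuclideanSpace ℂ (E₁ ⊕ E₁))} {Y₂ : Submodule ℂ (EuclideanSpace ℂ (E₂ ⊕ E₂))}

theorem eigenMultiplicity_eq_finrank {F : Type*} [AddCommGroup F] [Module ℂ F] (T : F →ₗ.[ℂ] F)
    (μ : ℂ) [FiniteDimensional ℂ (eigenspace T μ)] :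
    eigenMultiplicity T μ = finrank ℂ (eigenspace T μ) := by
  rw [eigenMultiplicity, ← finrank_eq_rank, Cardinal.toENat_nat]

theorem isospectral_neg_laplacian_iff :
    Isospectral (-laplacian Y₁) (-laplacian Y₂) ↔ ∀ μ,
      finrank ℂ (eigenspace (-laplacian Y₁) μ) = finrank ℂ (eigenspace (-laplacian Y₂) μ) := by
  simp only [Isospectral, eigenMultiplicity_eq_finrank, Nat.cast_inj]

theorem Isospectral.orthogonal (h : Isospectral (-laplacian Y₁) (-laplacian Y₂)) :
    Isospectral (-laplacian Y₁ᗮ) (-laplacian Y₂ᗮ) := by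
  rw [isospectral_neg_laplacian_iff] at h ⊢
  intro μ
  obtain ⟨k, rfl⟩ := IsAlgClosed.exists_pow_nat_eq μ two_pos
  rcases eq_or_ne k 0 with rfl | hk
  · have h₁ := finrank_eigenspace_zero_orthogonal_add Y₁
    have h₂ := finrank_eigenspace_zero_orthogonal_add Y₂
    rw [h, h, h] at h₁
    rw [zero_pow two_ne_zero]
    omega
  · obtain ⟨k', hk', hcos, hsin⟩ := exists_cos_eq_neg_cos_and_sin_eq_sin k
    rw [finrank_eigenspace_sq_orthogonal Y₁ hk hk' hcos hsin,
      finrank_eigenspace_sq_orthogonal Y₂ hk hk' hcos hsin, h]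

end Isospectrality

end MetricGraph

end

theorem corollary5p2_general {E₁ E₂ : Type*} [Fintype E₁] [Fintype E₂]
    (Y₁ : Submodule ℂ (EuclideanSpace ℂ (E₁ ⊕ E₁)))
    (Y₂ : Submodule ℂ (EuclideanSpace ℂ (E₂ ⊕ E₂))) :
    MetricGraph.Isospectral (-MetricGraph.laplacian Y₁) (-MetricGraph.laplacian Y₂) ↔
      MetricGraph.Isospectral (-MetricGraph.laplacian Y₁ᗮ) (-MetricGraph.laplacian Y₂ᗮ) :=
  ⟨.orthogonal, fun h => by simpa only [Submodule.orthogonal_orthogonal] using h.orthogonal⟩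

theorem corollary5p2 {V₁ V₂ : Type*}
    [Fintype V₁] [DecidableEq V₁] [Fintype V₂] [DecidableEq V₂]
    (G₁ : SimpleGraph V₁) (G₂ : SimpleGraph V₂)
    [DecidableRel G₁.Adj] [DecidableRel G₂.Adj]
    (o₁ : MetricGraph.EdgeOrientation G₁) (o₂ : MetricGraph.EdgeOrientation G₂) :
    MetricGraph.Isospectral (-MetricGraph.laplacianCK o₁) (-MetricGraph.laplacianCK o₂) ↔
      MetricGraph.Isospectral (-MetricGraph.laplacianKC o₁) (-MetricGraph.laplacianKC o₂) :=
  corollary5p2_general _ _
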